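/- A subtree of a finite tree $T$ is a (non-empty) induced subgraph of $T$ that is itself a tree. The mean subtree order of $T$ is the average number of vertices of a subtree, taken over all subtrees of $T$. Call a tree $T$ with $n$ vertices optimal if its mean subtree order is the greatest possible among all trees with $n$ vertices. Then the number of subtrees of an optimal tree with $n$ vertices is $\Theta(n^4)$; precisely, there are absolute constants $C_1 > 0$ and $C_2 > 0$ such that, for every $n \ge 1$ and every optimal tree $T$ with $n$ vertices, the number of subtrees of $T$ is at most $C_1 n^4$ and at least $C_2 n^4$. -/

import Mathlib

namespace MeanSubtree

open Classical in
/-- The (vertex sets of) subtrees of a finite graph `G`: the vertex sets whose induced subgraph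
is a tree. A tree is non-empty, so the empty set is not a subtree. -/
noncomputable def subtrees {V : Type*} [Fintype V] (G : SimpleGraph V) : Finset (Finset V) :=
  Finset.univ.filter fun s : Finset V => (G.induce (s : Set V)).IsTree

/-- `σ(G)`: the number of subtrees. -/
noncomputable def numSubtrees {V : Type*} [Fintype V] (G : SimpleGraph V) : ℕ :=
  (subtrees G).card

/-- `τ(G)`: the total number of vertices in all subtrees. -/
noncomputable def totalSubtreeOrder {V : Type*} [Fintype V] (G : SimpleGraph V) : ℕ :=
  ∑ s ∈ subtrees G, s.card

/-- The mean subtree order `μ_G = τ(G) / σ(G)`. -/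
noncomputable def meanSubtreeOrder {V : Type*} [Fintype V] (G : SimpleGraph V) : ℝ :=
  (totalSubtreeOrder G : ℝ) / (numSubtrees G : ℝ)

/-- `T` is an optimal tree: it is a tree, and no tree with the same number `n` of vertices has a
greater mean subtree order. Every tree with `n` vertices is isomorphic to one on `Fin n`, so it is
enough to compare with the trees on that vertex set. -/
def IsOptimal {V : Type*} [Fintype V] (T : SimpleGraph V) : Prop :=
  T.IsTree ∧ ∀ T' : SimpleGraph (Fin (Fintype.card V)), T'.IsTree →
    meanSubtreeOrder T' ≤ meanSubtreeOrder T

end MeanSubtree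

namespace MeanSubtree

/-! Work with the deficiency: a subtree on a vertex set `S` in a tree of order n misses n - |S|
vertices, and n minus the mean subtree order is the mean deficiency. Optimal trees are those of
least mean deficiency.

Upper bound on this minimum: in a double broom with k ≈ 2 log₂ n leaves at each end, almost every
subtree contains the whole path, and such a subtree misses k leaves on average. Hence an optimal
tree has mean deficiency at most 2 log₂ n + 6 (`IsOptimal.deficiency_le`).

Lower bound for any tree: let a be the number of subtrees containing a root v of a tree of order m.
By induction along edges at the root, their total deficiency is at least (a/2) log₂ a + (m - 1 -
log₂ a)²/2 (`rootedSubtrees_bounds`). The first term is sharp for stars rooted at the centre; the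
second penalises having few subtrees. Cut the tree at a vertex v into two sides of linear size, with
a and b rooted subtrees. The ab subtrees through v are products, and their mean deficiencies add. A
subtree avoiding v misses a whole side, so these are few when the mean deficiency is small. This
yields (log₂ a + log₂ b)/2 + (n²/72)(1/a + 1/b) ≤ 2 log₂ n + 6
(`exists_factorization_of_deficiency_le`).

The logarithms force ab = O(n⁴); AM-GM on the reciprocals forces ab = Ω(n⁴)
(`mul_bounds_of_logb_add_le`). The number of subtrees lies between ab and 2ab. -/

/-! ### Connectedness through cuts. -/

/-- `S` contains `v` and induces a connected subgraph of `G`, expressed through cuts: every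
non-empty part of `S` that avoids `v` is joined by an edge to the rest of `S`. -/
def RootedConn {V : Type*} (G : SimpleGraph V) (S : Finset V) (v : V) : Prop :=
  v ∈ S ∧ ∀ X ⊆ S, X.Nonempty → v ∉ X → ∃ x ∈ X, ∃ y ∈ S, y ∉ X ∧ G.Adj x y

lemma rootedConn_iff_induce_connected {V : Type*} {G : SimpleGraph V} {S : Finset V} {v : V}
    (hv : v ∈ S) : RootedConn G S v ↔ (G.induce (S : Set V)).Connected := by
  classical
  constructor
  · rintro ⟨-, h⟩
    rw [SimpleGraph.connected_iff_exists_forall_reachable]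
    refine ⟨⟨v, hv⟩, ?_⟩
    by_contra! hcon
    obtain ⟨w, hw⟩ := hcon
    let X := S.filter fun x => ∃ hx : x ∈ S, ¬ (G.induce (S : Set V)).Reachable ⟨v, hv⟩ ⟨x, hx⟩
    obtain ⟨x, hx, y, hy, hyX, hxy⟩ := h X (Finset.filter_subset _ _)
      ⟨w.1, Finset.mem_filter.2 ⟨w.2, w.2, hw⟩⟩
      (fun hvX => by
        obtain ⟨-, _, h2⟩ := Finset.mem_filter.1 hvX
        exact h2 (SimpleGraph.Reachable.refl _))
    obtain ⟨-, hxS, hxn⟩ := Finset.mem_filter.1 hx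
    have hyr : (G.induce (S : Set V)).Reachable ⟨v, hv⟩ ⟨y, hy⟩ := by
      by_contra hn
      exact hyX (Finset.mem_filter.2 ⟨hy, hy, hn⟩)
    exact hxn (hyr.trans (SimpleGraph.Adj.reachable (by simpa using hxy.symm)))
  · intro h
    refine ⟨hv, fun X hX ⟨x, hx⟩ hvX => ?_⟩
    obtain ⟨p⟩ := h.preconnected ⟨x, hX hx⟩ ⟨v, hv⟩
    obtain ⟨d, -, hd1, hd2⟩ := p.exists_boundary_dart {z | z.1 ∈ X} hx hvX
    exact ⟨d.fst.1, hd1, d.snd.1, d.snd.2, hd2, d.adj⟩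

lemma RootedConn.reroot {V : Type*} {G : SimpleGraph V} {S : Finset V} {v w : V}
    (h : RootedConn G S v) (hw : w ∈ S) : RootedConn G S w :=
  (rootedConn_iff_induce_connected hw).2 ((rootedConn_iff_induce_connected h.1).1 h)

lemma rootedConn_singleton {V : Type*} (G : SimpleGraph V) (v : V) : RootedConn G {v} v := by
  refine ⟨by simp, fun X hX ⟨x, hx⟩ hv => ?_⟩
  have := hX hx
  simp only [Finset.mem_singleton] at this
  exact absurd (this ▸ hx) hv

/-- An edge leaving a part of `S ∩ A` towards `B` outside `A` would have to start at `v`, which the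
part avoids. -/
lemma RootedConn.inter_left {V : Type*} [DecidableEq V] {G : SimpleGraph V} {S A B : Finset V}
    {v : V} (h : RootedConn G S v) (hS : S ⊆ A ∪ B) (hv : v ∈ A)
    (hAB : ∀ x ∈ A, ∀ y ∈ B, y ∉ A → G.Adj x y → x = v) : RootedConn G (S ∩ A) v := by
  refine ⟨Finset.mem_inter.2 ⟨h.1, hv⟩, fun X hX hne hvX => ?_⟩
  obtain ⟨x, hx, y, hy, hyX, hxy⟩ := h.2 X (hX.trans Finset.inter_subset_left) hne hvX
  refine ⟨x, hx, y, ?_, hyX, hxy⟩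
  by_contra hyA
  have hyA' : y ∉ A := fun h => hyA (Finset.mem_inter.2 ⟨hy, h⟩)
  have hyB : y ∈ B := (Finset.mem_union.1 (hS hy)).resolve_left hyA'
  exact hvX (hAB x (Finset.mem_inter.1 (hX hx)).2 y hyB hyA' hxy ▸ hx)

lemma RootedConn.union {V : Type*} [DecidableEq V] {G : SimpleGraph V} {S₁ S₂ : Finset V}
    {v : V} (h₁ : RootedConn G S₁ v) (h₂ : RootedConn G S₂ v) : RootedConn G (S₁ ∪ S₂) v := by
  refine ⟨Finset.mem_union_left _ h₁.1, fun X hX ⟨x, hx⟩ hvX => ?_⟩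
  have key : ∀ S : Finset V, RootedConn G S v → S ⊆ S₁ ∪ S₂ → x ∈ S →
      ∃ x ∈ X, ∃ y ∈ S₁ ∪ S₂, y ∉ X ∧ G.Adj x y := by
    intro S hS hSS hxS
    obtain ⟨x', hx', y, hy, hyX, hxy⟩ := hS.2 (X ∩ S) Finset.inter_subset_right
      ⟨x, Finset.mem_inter.2 ⟨hx, hxS⟩⟩ (fun h => hvX (Finset.mem_inter.1 h).1)
    exact ⟨x', (Finset.mem_inter.1 hx').1, y, hSS hy,
      fun h => hyX (Finset.mem_inter.2 ⟨h, hy⟩), hxy⟩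
  rcases Finset.mem_union.1 (hX hx) with h | h
  · exact key S₁ h₁ Finset.subset_union_left h
  · exact key S₂ h₂ Finset.subset_union_right h

lemma RootedConn.insert_adj {V : Type*} [DecidableEq V] {G : SimpleGraph V} {S : Finset V}
    {v w : V} (h : RootedConn G S w) (hvw : G.Adj v w) : RootedConn G (insert v S) v := by
  refine ⟨Finset.mem_insert_self _ _, fun X hX hne hvX => ?_⟩
  have hXS : X ⊆ S := fun x hx => (Finset.mem_insert.1 (hX hx)).resolve_left
    (fun h => hvX (h ▸ hx))
  by_cases hw : w ∈ X
  · exact ⟨w, hw, v, Finset.mem_insert_self _ _, hvX, hvw.symm⟩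
  · obtain ⟨x, hx, y, hy, hyX, hxy⟩ := h.2 X hXS hne hw
    exact ⟨x, hx, y, Finset.mem_insert_of_mem hy, hyX, hxy⟩

/-! ### Rooted subtrees, deficiency and product formulas. -/

open Classical in
/-- The subtrees of `G` with all vertices in `A` that contain `v` (for acyclic `G`). -/
noncomputable def rootedSubtrees {V : Type*} (G : SimpleGraph V) (A : Finset V) (v : V) :
    Finset (Finset V) :=
  A.powerset.filter fun S => RootedConn G S v

lemma mem_rootedSubtrees {V : Type*} {G : SimpleGraph V} {A S : Finset V} {v : V} :
    S ∈ rootedSubtrees G A v ↔ S ⊆ A ∧ RootedConn G S v := by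
  simp [rootedSubtrees]

/-- The total number of vertices of `A` missed by the members of a family of sets. -/
noncomputable def deficiency {V : Type*} (A : Finset V) (𝓕 : Finset (Finset V)) : ℝ :=
  ∑ S ∈ 𝓕, ((A.card : ℝ) - S.card)

/-- The map `S ↦ (S ∩ A, S ∩ B)` is a bijection onto the product along which missed vertices add. It
serves both splittings below: along an edge, where `A` and `B` are disjoint, and at a vertex, where
they share it. -/
lemma card_and_deficiency_of_product {V : Type*} [DecidableEq V] {A B C : Finset V}
    {𝓐 𝓑 𝓒 : Finset (Finset V)}
    (hC : ∀ S ∈ 𝓒, S ∩ A ∈ 𝓐 ∧ S ∩ B ∈ 𝓑 ∧ S ∩ A ∪ S ∩ B = S)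
    (hAB : ∀ S₁ ∈ 𝓐, ∀ S₂ ∈ 𝓑, S₁ ∪ S₂ ∈ 𝓒 ∧ (S₁ ∪ S₂) ∩ A = S₁ ∧ (S₁ ∪ S₂) ∩ B = S₂)
    (hcard : ∀ S₁ ∈ 𝓐, ∀ S₂ ∈ 𝓑,
      (C.card : ℝ) - (S₁ ∪ S₂).card = (A.card - S₁.card) + (B.card - S₂.card)) :
    𝓒.card = 𝓐.card * 𝓑.card ∧
      deficiency C 𝓒 = deficiency A 𝓐 * 𝓑.card + 𝓐.card * deficiency B 𝓑 := by
  constructor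
  · rw [← Finset.card_product]
    refine Finset.card_bij' (fun S _ => (S ∩ A, S ∩ B)) (fun p _ => p.1 ∪ p.2) ?_ ?_ ?_ ?_
    · exact fun S hS => Finset.mem_product.2 ⟨(hC S hS).1, (hC S hS).2.1⟩
    · exact fun p hp => (hAB _ (Finset.mem_product.1 hp).1 _ (Finset.mem_product.1 hp).2).1
    · exact fun S hS => (hC S hS).2.2
    · exact fun p hp => Prod.ext_iff.2
        (hAB _ (Finset.mem_product.1 hp).1 _ (Finset.mem_product.1 hp).2).2
  · have : deficiency C 𝓒 = ∑ p ∈ 𝓐 ×ˢ 𝓑,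
        (((A.card : ℝ) - p.1.card) + ((B.card : ℝ) - p.2.card)) := by
      refine Finset.sum_bij' (fun S _ => (S ∩ A, S ∩ B)) (fun p _ => p.1 ∪ p.2) ?_ ?_ ?_ ?_ ?_
      · exact fun S hS => Finset.mem_product.2 ⟨(hC S hS).1, (hC S hS).2.1⟩
      · exact fun p hp => (hAB _ (Finset.mem_product.1 hp).1 _ (Finset.mem_product.1 hp).2).1
      · exact fun S hS => (hC S hS).2.2
      · exact fun p hp => Prod.ext_iff.2
          (hAB _ (Finset.mem_product.1 hp).1 _ (Finset.mem_product.1 hp).2).2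
      · intro S hS
        rw [← hcard _ (hC S hS).1 _ (hC S hS).2.1, (hC S hS).2.2]
    rw [this, Finset.sum_product]
    simp only [Finset.sum_add_distrib, Finset.sum_const, nsmul_eq_mul, deficiency, Finset.mul_sum,
      Finset.sum_mul]
    congr 1
    exact Finset.sum_congr rfl fun _ _ => mul_comm _ _

/-- Splitting the rooted subtrees along an edge `vw` that is the only one between `A` and `B`. -/
lemma rootedSubtrees_union_of_bridge {V : Type*} [DecidableEq V] {G : SimpleGraph V}
    {A B : Finset V} {v w : V} (hdisj : Disjoint A B) (hv : v ∈ A) (hw : w ∈ B)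
    (hvw : G.Adj v w) (hAB : ∀ x ∈ A, ∀ y ∈ B, G.Adj x y → x = v ∧ y = w) :
    (rootedSubtrees G (A ∪ B) v).card =
        (rootedSubtrees G A v).card * ((rootedSubtrees G B w).card + 1) ∧
      deficiency (A ∪ B) (rootedSubtrees G (A ∪ B) v) =
        deficiency A (rootedSubtrees G A v) * ((rootedSubtrees G B w).card + 1 : ℕ) +
        (rootedSubtrees G A v).card * (deficiency B (rootedSubtrees G B w) + B.card) := by
  -- A subtree rooted at `v` meets `B` in a subtree rooted at `w` or not at all. The empty set gives
  -- the `+ 1`, and it misses all of `B`.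
  have hemp : ∅ ∉ rootedSubtrees G B w := fun h => by
    simpa using (mem_rootedSubtrees.1 h).2.1
  have hcd : (insert ∅ (rootedSubtrees G B w)).card = (rootedSubtrees G B w).card + 1 :=
    Finset.card_insert_of_notMem hemp
  have hdf : deficiency B (insert ∅ (rootedSubtrees G B w)) =
      deficiency B (rootedSubtrees G B w) + B.card := by
    rw [deficiency, Finset.sum_insert hemp, deficiency]
    simp [add_comm]
  rw [← hcd, ← hdf]
  refine card_and_deficiency_of_product ?_ ?_ ?_
  · intro S hS
    obtain ⟨hSs, hS⟩ := mem_rootedSubtrees.1 hS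
    refine ⟨mem_rootedSubtrees.2 ⟨Finset.inter_subset_right,
      hS.inter_left hSs hv fun x hx y hy _ hxy => (hAB x hx y hy hxy).1⟩, ?_, ?_⟩
    · rw [Finset.mem_insert, or_iff_not_imp_left]
      intro hne
      have hvB : v ∉ B := Finset.disjoint_left.1 hdisj hv
      have hwS : w ∈ S := by
        obtain ⟨x, hx, y, hy, hyX, hxy⟩ := hS.2 (S ∩ B) Finset.inter_subset_left
          (Finset.nonempty_iff_ne_empty.2 hne) (fun h => hvB (Finset.mem_inter.1 h).2)
        have hyA : y ∈ A := (Finset.mem_union.1 (hSs hy)).resolve_right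
          fun h => hyX (Finset.mem_inter.2 ⟨hy, h⟩)
        exact (hAB y hyA x (Finset.mem_inter.1 hx).2 hxy.symm).2 ▸ (Finset.mem_inter.1 hx).1
      refine mem_rootedSubtrees.2 ⟨Finset.inter_subset_right,
        (hS.reroot hwS).inter_left (B := A) (by rwa [Finset.union_comm]) hw ?_⟩
      exact fun x hx y hy _ hxy => (hAB y hy x hx hxy.symm).2
    · rw [← Finset.inter_union_distrib_left, Finset.inter_eq_left.2 hSs]
  · intro S₁ h₁ S₂ h₂
    obtain ⟨hs₁, h₁⟩ := mem_rootedSubtrees.1 h₁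
    have hs₂ : S₂ ⊆ B := by
      rcases Finset.mem_insert.1 h₂ with rfl | h₂
      · exact Finset.empty_subset _
      · exact (mem_rootedSubtrees.1 h₂).1
    refine ⟨mem_rootedSubtrees.2 ⟨Finset.union_subset_union hs₁ hs₂, ?_⟩, ?_, ?_⟩
    · rcases Finset.mem_insert.1 h₂ with rfl | h₂
      · simpa using h₁
      · have := h₁.union ((mem_rootedSubtrees.1 h₂).2.insert_adj hvw)
        rwa [Finset.union_insert, Finset.insert_eq_self.2 (Finset.mem_union_left _ h₁.1)] at this
    · have : S₂ ∩ A = ∅ := Finset.disjoint_iff_inter_eq_empty.1 (hdisj.symm.mono_left hs₂)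
      rw [Finset.union_inter_distrib_right, this, Finset.inter_eq_left.2 hs₁, Finset.union_empty]
    · have : S₁ ∩ B = ∅ := Finset.disjoint_iff_inter_eq_empty.1 (hdisj.mono_left hs₁)
      rw [Finset.union_inter_distrib_right, this, Finset.inter_eq_left.2 hs₂, Finset.empty_union]
  · intro S₁ h₁ S₂ h₂
    have hs₁ := (mem_rootedSubtrees.1 h₁).1
    have hs₂ : S₂ ⊆ B := by
      rcases Finset.mem_insert.1 h₂ with rfl | h₂
      · exact Finset.empty_subset _
      · exact (mem_rootedSubtrees.1 h₂).1
    rw [Finset.card_union_of_disjoint hdisj, Finset.card_union_of_disjoint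
      (hdisj.mono hs₁ hs₂)]
    push_cast
    ring

/-- Splitting the rooted subtrees at a cut vertex `v`. -/
lemma rootedSubtrees_union_of_cut_vertex {V : Type*} [DecidableEq V] {G : SimpleGraph V}
    {A B : Finset V} {v : V} (hinter : A ∩ B = {v})
    (hAB : ∀ x ∈ A, ∀ y ∈ B, G.Adj x y → x = v ∨ y = v) :
    (rootedSubtrees G (A ∪ B) v).card =
        (rootedSubtrees G A v).card * (rootedSubtrees G B v).card ∧
      deficiency (A ∪ B) (rootedSubtrees G (A ∪ B) v) =
        deficiency A (rootedSubtrees G A v) * (rootedSubtrees G B v).card +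
        (rootedSubtrees G A v).card * deficiency B (rootedSubtrees G B v) := by
  have hvAB : v ∈ A ∩ B := by simp [hinter]
  have hvA := (Finset.mem_inter.1 hvAB).1
  have hvB := (Finset.mem_inter.1 hvAB).2
  have hsmall : ∀ S ∈ rootedSubtrees G A v, ∀ S' ∈ rootedSubtrees G B v, S ∩ S' = {v} := by
    intro S hS S' hS'
    obtain ⟨h1, h2⟩ := mem_rootedSubtrees.1 hS
    obtain ⟨h3, h4⟩ := mem_rootedSubtrees.1 hS'
    refine Finset.Subset.antisymm (hinter ▸ Finset.inter_subset_inter h1 h3) ?_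
    simp [h2.1, h4.1]
  refine card_and_deficiency_of_product ?_ ?_ ?_
  · intro S hS
    obtain ⟨hSs, hS⟩ := mem_rootedSubtrees.1 hS
    refine ⟨mem_rootedSubtrees.2 ⟨Finset.inter_subset_right, hS.inter_left hSs hvA ?_⟩,
      mem_rootedSubtrees.2 ⟨Finset.inter_subset_right,
        hS.inter_left (B := A) (by rwa [Finset.union_comm]) hvB ?_⟩, ?_⟩
    · exact fun x hx y hy hyA hxy => (hAB x hx y hy hxy).resolve_right fun h => hyA (h ▸ hvA)
    · exact fun x hx y hy hyB hxy => (hAB y hy x hx hxy.symm).resolve_left fun h => hyB (h ▸ hvB)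
    · rw [← Finset.inter_union_distrib_left, Finset.inter_eq_left.2 hSs]
  · intro S₁ h₁ S₂ h₂
    obtain ⟨hs₁, h₁⟩ := mem_rootedSubtrees.1 h₁
    obtain ⟨hs₂, h₂⟩ := mem_rootedSubtrees.1 h₂
    refine ⟨mem_rootedSubtrees.2 ⟨Finset.union_subset_union hs₁ hs₂, h₁.union h₂⟩, ?_, ?_⟩
    · have : S₂ ∩ A ⊆ S₁ := fun x hx => by
        have : x ∈ A ∩ B := Finset.mem_inter.2
          ⟨(Finset.mem_inter.1 hx).2, hs₂ (Finset.mem_inter.1 hx).1⟩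
        rw [hinter, Finset.mem_singleton] at this
        exact this ▸ h₁.1
      rw [Finset.union_inter_distrib_right, Finset.inter_eq_left.2 hs₁,
        Finset.union_eq_left.2 this]
    · have : S₁ ∩ B ⊆ S₂ := fun x hx => by
        have : x ∈ A ∩ B := Finset.mem_inter.2
          ⟨hs₁ (Finset.mem_inter.1 hx).1, (Finset.mem_inter.1 hx).2⟩
        rw [hinter, Finset.mem_singleton] at this
        exact this ▸ h₂.1
      rw [Finset.union_inter_distrib_right, Finset.inter_eq_left.2 hs₂,
        Finset.union_eq_right.2 this]
  · intro S₁ h₁ S₂ h₂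
    have e1 := Finset.card_union_add_card_inter S₁ S₂
    have e2 := Finset.card_union_add_card_inter A B
    rw [hsmall S₁ h₁ S₂ h₂, Finset.card_singleton] at e1
    rw [hinter, Finset.card_singleton] at e2
    have e1' : ((S₁ ∪ S₂).card : ℝ) + 1 = S₁.card + S₂.card := by exact_mod_cast e1
    have e2' : ((A ∪ B).card : ℝ) + 1 = A.card + B.card := by exact_mod_cast e2
    linarith

/-- In an acyclic graph every edge `vw` has a set of vertices on the side of `w` that no other
edge leaves. -/
lemma exists_bridge_side {V : Type*} [Fintype V] {G : SimpleGraph V} (hG : G.IsAcyclic) {v w : V}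
    (hvw : G.Adj v w) : ∃ K : Finset V, w ∈ K ∧ v ∉ K ∧
      ∀ x ∉ K, ∀ y ∈ K, G.Adj x y → x = v ∧ y = w := by
  classical
  have hb := SimpleGraph.isAcyclic_iff_forall_adj_isBridge.1 hG hvw
  rw [SimpleGraph.isBridge_iff] at hb
  refine ⟨Finset.univ.filter fun x => (G.deleteEdges {s(v, w)}).Reachable x w, by simp,
    by simpa using hb, ?_⟩
  intro x hx y hy hxy
  simp only [Finset.mem_filter, Finset.mem_univ, true_and] at hx hy
  have he : s(x, y) = s(v, w) := by
    by_contra hne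
    have : (G.deleteEdges {s(v, w)}).Adj x y := by
      rw [SimpleGraph.deleteEdges_adj]
      exact ⟨hxy, hne⟩
    exact hx (this.reachable.trans hy)
  rcases Sym2.eq_iff.1 he with h | ⟨rfl, rfl⟩
  · exact h
  · exact absurd hy hb

/-! ### Lower bound for the deficiency of rooted subtrees. -/

/-- This is (1 + 1/a)^(a+1) ≤ 4, with equality at a = 1. From a = 3 on, log(1 + 1/a) ≤ 1/a suffices,
since 4/3 < 2 log 2. -/
lemma add_one_mul_logb_one_add_inv_le {a : ℕ} (ha : 1 ≤ a) :
    ((a : ℝ) + 1) * (Real.logb 2 (a + 1) - Real.logb 2 a) ≤ 2 := by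
  have ha' : (1 : ℝ) ≤ a := by exact_mod_cast ha
  have h2 : (0 : ℝ) < Real.log 2 := Real.log_pos one_lt_two
  rw [← Real.logb_div (by positivity) (by positivity), Real.logb, ← mul_div_assoc,
    div_le_iff₀ h2]
  have hx : ((a : ℝ) + 1) / a = 1 + 1 / a := by field_simp
  rcases Nat.lt_or_ge a 3 with h3 | h3
  · interval_cases a
    · norm_num
    · have : (3 : ℝ) * Real.log (3 / 2) ≤ 2 * Real.log 2 := by
        have e1 : (3 : ℝ) * Real.log (3 / 2) = Real.log ((3 / 2) ^ 3) := by
          rw [Real.log_pow]; norm_num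
        have e2 : (2 : ℝ) * Real.log 2 = Real.log (2 ^ 2) := by
          rw [Real.log_pow]; norm_num
        rw [e1, e2]
        exact Real.log_le_log (by norm_num) (by norm_num)
      norm_num at this ⊢
      linarith
  · have h3' : (3 : ℝ) ≤ a := by exact_mod_cast h3
    have hlog := Real.log_le_sub_one_of_pos (show (0 : ℝ) < ((a : ℝ) + 1) / a by positivity)
    have h693 := Real.log_two_gt_d9
    have hle : ((a : ℝ) + 1) * Real.log (((a : ℝ) + 1) / a) ≤ ((a : ℝ) + 1) * (1 / a) := by
      refine mul_le_mul_of_nonneg_left ?_ (by positivity)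
      linarith
    have : ((a : ℝ) + 1) * (1 / a) ≤ 4 / 3 := by
      rw [mul_one_div, div_le_div_iff₀ (by positivity) (by norm_num)]
      linarith
    linarith

/-- Inductive step for admitting the empty set: `a` grows by one and the deficiency by `m`. The
previous lemma controls the growth of the entropy term; for `a ≥ 2` the change of the square is
absorbed because `logb 2 a ≥ 1`. -/
lemma deficiency_bound_add_empty {a m : ℕ} {F : ℝ} (ha : 1 ≤ a) (hm : a ≤ 2 ^ (m - 1))
    (hm1 : 1 ≤ m)
    (hF : a / 2 * Real.logb 2 a + ((m : ℝ) - 1 - Real.logb 2 a) ^ 2 / 2 ≤ F) :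
    ((a : ℝ) + 1) / 2 * Real.logb 2 (a + 1) + ((m : ℝ) - Real.logb 2 (a + 1)) ^ 2 / 2
      ≤ F + m := by
  have ha' : (1 : ℝ) ≤ a := by exact_mod_cast ha
  have key := add_one_mul_logb_one_add_inv_le ha
  have hlm : Real.logb 2 a ≤ (m : ℝ) - 1 := by
    have h : (a : ℝ) ≤ 2 ^ ((m - 1 : ℕ) : ℝ) := by
      rw [Real.rpow_natCast]; exact_mod_cast hm
    have := (Real.logb_le_iff_le_rpow one_lt_two (by positivity)).2 h
    rwa [Nat.cast_sub hm1, Nat.cast_one] at this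
  rcases Nat.eq_or_lt_of_le ha with rfl | h2
  · have hm1' : (1 : ℝ) ≤ m := by exact_mod_cast hm1
    norm_num [Real.logb_self_eq_one] at hF ⊢
    linarith
  · have h2' : (2 : ℝ) ≤ a := by exact_mod_cast h2
    have hl1 : 1 ≤ Real.logb 2 a := by
      rw [Real.le_logb_iff_rpow_le one_lt_two (by positivity)]; simpa using h2'
    have hmono : Real.logb 2 a ≤ Real.logb 2 (a + 1) :=
      Real.logb_le_logb_of_le one_lt_two (by positivity) (by linarith)
    have hmono' : Real.logb 2 (a + 1) ≤ Real.logb 2 a + 1 := by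
      nlinarith
    nlinarith

/-- The entropy terms add exactly, so the claim reduces to (x + y)² ≤ b x² + a y². This follows from
(x + y)² ≤ 2x² + 2y² if a, b ≥ 2, and is trivial if x = 0. -/
lemma deficiency_bound_mul {a b x y F₁ F₂ : ℝ} (ha : 1 ≤ a) (hb : 2 ≤ b)
    (hx : 0 ≤ x) (hax : x = 0 ∨ 2 ≤ a)
    (h₁ : a / 2 * Real.logb 2 a + x ^ 2 / 2 ≤ F₁)
    (h₂ : b / 2 * Real.logb 2 b + y ^ 2 / 2 ≤ F₂) :
    a * b / 2 * Real.logb 2 (a * b) + (x + y) ^ 2 / 2 ≤ F₁ * b + a * F₂ := by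
  rw [Real.logb_mul (by positivity) (by positivity)]
  have e1 := mul_le_mul_of_nonneg_right h₁ (show 0 ≤ b by linarith)
  have e2 := mul_le_mul_of_nonneg_left h₂ (show 0 ≤ a by linarith)
  rcases hax with rfl | ha2
  · nlinarith [sq_nonneg y]
  · nlinarith [sq_nonneg y, sq_nonneg x, sq_nonneg (x - y)]

/-- Bounds for the number and the total deficiency of the rooted subtrees. -/
lemma rootedSubtrees_bounds {V : Type*} [Fintype V] {G : SimpleGraph V} (hG : G.IsAcyclic)
    (A : Finset V) (v : V) (hA : RootedConn G A v) :
    A.card ≤ (rootedSubtrees G A v).card ∧ (rootedSubtrees G A v).card ≤ 2 ^ (A.card - 1) ∧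
    ((rootedSubtrees G A v).card : ℝ) / 2 * Real.logb 2 (rootedSubtrees G A v).card +
      ((A.card : ℝ) - 1 - Real.logb 2 (rootedSubtrees G A v).card) ^ 2 / 2 ≤
      deficiency A (rootedSubtrees G A v) := by
  classical
  induction hn : A.card using Nat.strong_induction_on generalizing A v with
  | _ n ih =>
  subst hn
  by_cases hAv : A \ {v} = ∅
  · have hA1 : A = {v} := Finset.Subset.antisymm (Finset.sdiff_eq_empty_iff_subset.1 hAv)
      (by simpa using hA.1)
    subst hA1
    have : rootedSubtrees G {v} v = {{v}} := by
      ext S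
      rw [mem_rootedSubtrees, Finset.mem_singleton]
      constructor
      · rintro ⟨h1, h2⟩
        exact Finset.Subset.antisymm h1 (by simpa using h2.1)
      · rintro rfl
        exact ⟨subset_rfl, rootedConn_singleton G v⟩
    simp [this, deficiency]
  · obtain ⟨w, hw, v', hv', hv'X, hwv⟩ := hA.2 (A \ {v}) Finset.sdiff_subset
      (Finset.nonempty_iff_ne_empty.2 hAv) (by simp)
    obtain rfl : v' = v := by
      by_contra h
      exact hv'X (by simp [hv', h])
    obtain ⟨K, hwK, hvK, hK⟩ := exists_bridge_side hG hwv.symm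
    have hwA : w ∈ A := (Finset.mem_sdiff.1 hw).1
    have hdisj : Disjoint (A \ K) (A ∩ K) := Finset.disjoint_sdiff_inter A K
    have hun : A \ K ∪ A ∩ K = A := Finset.sdiff_union_inter A K
    have hv1 : v' ∈ A \ K := by simp [hA.1, hvK]
    have hw2 : w ∈ A ∩ K := by simp [hwA, hwK]
    have hedge : ∀ x ∈ A \ K, ∀ y ∈ A ∩ K, G.Adj x y → x = v' ∧ y = w := fun x hx y hy hxy =>
      hK x (Finset.mem_sdiff.1 hx).2 y (Finset.mem_inter.1 hy).2 hxy
    have hR1 : RootedConn G (A \ K) v' := by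
      have := hA.inter_left (A := A \ K) (B := A ∩ K) hun.ge hv1
        fun x hx y hy _ hxy => (hedge x hx y hy hxy).1
      rwa [Finset.inter_eq_right.2 Finset.sdiff_subset] at this
    have hR2 : RootedConn G (A ∩ K) w := by
      have := (hA.reroot hwA).inter_left (A := A ∩ K) (B := A \ K)
        (by rw [Finset.union_comm]; exact hun.ge) hw2
        fun x hx y hy _ hxy => (hedge y hy x hx hxy.symm).2
      rwa [Finset.inter_eq_right.2 Finset.inter_subset_left] at this
    have hcard : (A \ K).card + (A ∩ K).card = A.card := Finset.card_sdiff_add_card_inter A K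
    have hp1 : 1 ≤ (A \ K).card := Finset.card_pos.2 ⟨_, hv1⟩
    have hp2 : 1 ≤ (A ∩ K).card := Finset.card_pos.2 ⟨_, hw2⟩
    obtain ⟨i1, i2, i3⟩ := ih _ (by omega) _ _ hR1 rfl
    obtain ⟨j1, j2, j3⟩ := ih _ (by omega) _ _ hR2 rfl
    obtain ⟨hc, hd⟩ := rootedSubtrees_union_of_bridge hdisj hv1 hw2 hwv.symm hedge
    rw [hun] at hc hd
    rw [hc, hd, ← hcard]
    generalize (rootedSubtrees G (A \ K) v').card = a at *
    generalize (rootedSubtrees G (A ∩ K) w).card = b at *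
    generalize deficiency (A \ K) (rootedSubtrees G (A \ K) v') = F₁ at *
    generalize deficiency (A ∩ K) (rootedSubtrees G (A ∩ K) w) = F₂ at *
    generalize (A \ K).card = m₁ at *
    generalize (A ∩ K).card = m₂ at *
    refine ⟨by nlinarith, ?_, ?_⟩
    · have h3 : 2 ^ (m₁ + m₂ - 1) = 2 ^ (m₁ - 1) * 2 ^ m₂ := by
        rw [← pow_add]; congr 1; omega
      have h4 : 2 ^ m₂ = 2 * 2 ^ (m₂ - 1) := by
        rw [← pow_succ']; congr 1; omega
      rw [h3]
      refine Nat.mul_le_mul i2 ?_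
      have := Nat.one_le_two_pow (n := m₂ - 1)
      omega
    · have ha : 1 ≤ a := hp1.trans i1
      have hb : 1 ≤ b := hp2.trans j1
      have hb' : (1 : ℝ) ≤ b := by exact_mod_cast hb
      have ha' : (1 : ℝ) ≤ a := by exact_mod_cast ha
      have k := deficiency_bound_add_empty hb j2 hp2 j3
      have hx : (0 : ℝ) ≤ m₁ - 1 - Real.logb 2 a := by
        have h : (a : ℝ) ≤ 2 ^ ((m₁ - 1 : ℕ) : ℝ) := by
          rw [Real.rpow_natCast]; exact_mod_cast i2
        have := (Real.logb_le_iff_le_rpow one_lt_two (by positivity)).2 h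
        rw [Nat.cast_sub hp1, Nat.cast_one] at this
        linarith
      -- Only one rooted subtree means that the part is a single vertex, as `m₁ ≤ a`.
      have hax : (m₁ : ℝ) - 1 - Real.logb 2 a = 0 ∨ (2 : ℝ) ≤ a := by
        rcases Nat.eq_or_lt_of_le ha with h | h
        · left
          have : m₁ = 1 := by omega
          rw [← h, this]; simp
        · right; exact_mod_cast h
      have := deficiency_bound_mul ha' (show (2 : ℝ) ≤ b + 1 by linarith) hx hax i3 k
      push_cast
      refine le_trans (le_of_eq ?_) this
      rw [Real.logb_mul (by positivity) (by positivity)]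
      ring

/-! ### Balanced separations. -/

/-- A separation of order one: `A` and `B` cover the graph, meet only in `v`, and every edge
between them is incident with `v`. -/
structure IsSeparation {V : Type*} [Fintype V] [DecidableEq V] (G : SimpleGraph V)
    (A B : Finset V) (v : V) : Prop where
  union : A ∪ B = Finset.univ
  inter : A ∩ B = {v}
  adj : ∀ x ∈ A, ∀ y ∈ B, G.Adj x y → x = v ∨ y = v

lemma IsSeparation.symm {V : Type*} [Fintype V] [DecidableEq V] {G : SimpleGraph V}
    {A B : Finset V} {v : V} (h : IsSeparation G A B v) : IsSeparation G B A v :=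
  ⟨by rw [Finset.union_comm, h.union], by rw [Finset.inter_comm, h.inter],
    fun x hx y hy hxy => (h.adj y hy x hx hxy.symm).symm⟩

lemma IsSeparation.card_add_card {V : Type*} [Fintype V] [DecidableEq V] {G : SimpleGraph V}
    {A B : Finset V} {v : V} (h : IsSeparation G A B v) :
    A.card + B.card = Fintype.card V + 1 := by
  rw [← Finset.card_union_add_card_inter, h.union, h.inter, Finset.card_univ,
    Finset.card_singleton]

lemma IsSeparation.mem {V : Type*} [Fintype V] [DecidableEq V] {G : SimpleGraph V}
    {A B : Finset V} {v : V} (h : IsSeparation G A B v) : v ∈ A ∧ v ∈ B := by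
  rw [← Finset.mem_inter, h.inter]; simp

/-- Every tree has a separation of order one into two parts of linear size. -/
lemma exists_balanced_separation {V : Type*} [Fintype V] [DecidableEq V] {G : SimpleGraph V}
    (hG : G.IsTree) (hn : 2 ≤ Fintype.card V) : ∃ A B : Finset V, ∃ v : V,
      IsSeparation G A B v ∧ Fintype.card V + 1 ≤ 3 * A.card ∧
      Fintype.card V + 1 ≤ 3 * B.card := by
  classical
  have hne : Nonempty V := hG.connected.nonempty
  obtain ⟨v₀⟩ := hne
  have h₀ : IsSeparation G Finset.univ {v₀} v₀ :=
    ⟨by simp, by simp, fun x _ y hy _ => Or.inr (by simpa using hy)⟩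
  -- Choose a separation whose smaller side is as large as possible.
  obtain ⟨⟨A, B, v⟩, hmem, hmax⟩ := Finset.exists_max_image
    (Finset.univ.filter fun p : Finset V × Finset V × V => IsSeparation G p.1 p.2.1 p.2.2)
    (fun p => min p.1.card p.2.1.card) ⟨(Finset.univ, {v₀}, v₀), by simp [h₀]⟩
  simp only [Finset.mem_filter, Finset.mem_univ, true_and] at hmem hmax
  have hmax' : ∀ A' B' v', IsSeparation G A' B' v' →
      min A'.card B'.card ≤ min A.card B.card := fun A' B' v' h => hmax (A', B', v') h
  clear hmax h₀
  wlog hle : B.card ≤ A.card generalizing A B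
  · obtain ⟨A', B', v', h1, h2, h3⟩ := this B A hmem.symm (by simpa [min_comm] using hmax')
      (by omega)
    exact ⟨A', B', v', h1, h2, h3⟩
  have hsum := hmem.card_add_card
  rw [min_eq_right hle] at hmax'
  obtain ⟨hvA, hvB⟩ := hmem.mem
  have huniv : RootedConn G Finset.univ v := by
    rw [rootedConn_iff_induce_connected (Finset.mem_univ v), Finset.coe_univ]
    exact (SimpleGraph.induceUnivIso G).connected_iff.2 hG.connected
  have hXne : (A.erase v).Nonempty := by
    rw [← Finset.card_pos, Finset.card_erase_of_mem hvA]; omega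
  obtain ⟨w, hw, v', -, hv'X, hwv⟩ := huniv.2 (A.erase v) (Finset.subset_univ _) hXne (by simp)
  obtain ⟨hwv', hwA⟩ := Finset.mem_erase.1 hw
  obtain rfl : v' = v := by
    by_contra h
    have hv'B : v' ∈ B := by
      have : v' ∈ A ∪ B := by simp [hmem.union]
      refine (Finset.mem_union.1 this).resolve_left fun h' => hv'X (by simp [h, h'])
    exact (hmem.adj w hwA v' hv'B hwv).elim hwv' h
  obtain ⟨K, hwK, hvK, hK⟩ := exists_bridge_side hG.isAcyclic hwv.symm
  have hcov : ∀ x, x ∈ A ∨ x ∈ B := fun x => by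
    have : x ∈ A ∪ B := by simp [hmem.union]
    exact Finset.mem_union.1 this
  have hint : ∀ x, x ∈ A → x ∈ B → x = v' := fun x h1 h2 => by
    have : x ∈ A ∩ B := Finset.mem_inter.2 ⟨h1, h2⟩
    simpa [hmem.inter] using this
  have hcross : ∀ x, x ∉ A ∩ K → ∀ y ∈ A ∩ K, G.Adj x y → x = v' ∧ y = w := by
    intro x hx y hy hxy
    obtain ⟨hyA, hyK⟩ := Finset.mem_inter.1 hy
    by_cases hxK : x ∈ K
    · have hxA : x ∉ A := fun h => hx (Finset.mem_inter.2 ⟨h, hxK⟩)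
      have hxB := (hcov x).resolve_left hxA
      rcases hmem.adj y hyA x hxB hxy.symm with h | h
      · exact absurd (h ▸ hyK) hvK
      · exact absurd (h ▸ hvA) hxA
    · exact hK x hxK y hyK hxy
  have hwAK : w ∈ A ∩ K := Finset.mem_inter.2 ⟨hwA, hwK⟩
  -- Two competing separations: cut the branch `A ∩ K` off at `w`, or move it from `A` to `B`.
  have s1 : IsSeparation G (A ∩ K) (insert w (A ∩ K)ᶜ) w := by
    refine ⟨?_, ?_, ?_⟩
    · rw [Finset.union_insert, Finset.union_compl, Finset.insert_eq_self.2 (Finset.mem_univ _)]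
    · rw [Finset.inter_insert_of_mem hwAK, Finset.inter_compl]; rfl
    · intro x hx y hy hxy
      rcases Finset.mem_insert.1 hy with h | h
      · exact Or.inr h
      · exact Or.inl (hcross y (Finset.mem_compl.1 h) x hx hxy.symm).2
  have s2 : IsSeparation G (A \ (A ∩ K)) (B ∪ A ∩ K) v' := by
    refine ⟨?_, ?_, ?_⟩
    · ext x
      simp only [Finset.mem_union, Finset.mem_sdiff, Finset.mem_inter, Finset.mem_univ, iff_true]
      have := hcov x
      tauto
    · ext x
      simp only [Finset.mem_union, Finset.mem_sdiff, Finset.mem_inter, Finset.mem_singleton]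
      constructor
      · rintro ⟨⟨h1, h2⟩, h3 | h3⟩
        · exact hint x h1 h3
        · exact absurd h3 h2
      · rintro rfl
        exact ⟨⟨hvA, fun h => hvK h.2⟩, Or.inl hvB⟩
    · intro x hx y hy hxy
      obtain ⟨hxA, hxK⟩ := Finset.mem_sdiff.1 hx
      rcases Finset.mem_union.1 hy with h | h
      · exact hmem.adj x hxA y h hxy
      · exact Or.inl (hcross x hxK y h hxy).1
  have c1 := s1.card_add_card
  have c2 := s2.card_add_card
  -- In both competitors the second part is larger than `B`, so maximality bounds the first: |A ∩ K|
  -- ≤ |B| and |A \ K| ≤ |B|. Thus |A| ≤ 2|B|, and |A| + |B| = n + 1.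
  have m1 := hmax' _ _ _ s1
  have m2 := hmax' _ _ _ s2
  have hpos : 1 ≤ (A ∩ K).card := Finset.card_pos.2 ⟨w, hwAK⟩
  have hlt : (A ∩ K).card + 1 ≤ A.card :=
    Finset.card_lt_card ⟨Finset.inter_subset_left, fun h =>
      hvK (Finset.mem_inter.1 (h hvA)).2⟩
  have hsd : (A \ (A ∩ K)).card = A.card - (A ∩ K).card :=
    Finset.card_sdiff_of_subset Finset.inter_subset_left
  refine ⟨A, B, v', hmem, ?_, ?_⟩ <;> omega

/-! ### Mean subtree order in terms of deficiency. -/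

lemma mem_subtrees_iff {V : Type*} [Fintype V] {G : SimpleGraph V} (hG : G.IsAcyclic)
    {S : Finset V} : S ∈ subtrees G ↔ ∃ v, RootedConn G S v := by
  simp only [subtrees, Finset.mem_filter, Finset.mem_univ, true_and]
  constructor
  · intro h
    obtain ⟨v⟩ := h.connected.nonempty
    exact ⟨v.1, (rootedConn_iff_induce_connected v.2).2 h.connected⟩
  · rintro ⟨v, hv⟩
    exact ⟨(rootedConn_iff_induce_connected hv.1).1 hv, hG.induce _⟩

lemma numSubtrees_pos {V : Type*} [Fintype V] {G : SimpleGraph V} (hG : G.IsTree) :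
    0 < numSubtrees G := by
  obtain ⟨v⟩ := hG.connected.nonempty
  exact Finset.card_pos.2 ⟨{v}, (mem_subtrees_iff hG.isAcyclic).2 ⟨v, rootedConn_singleton G v⟩⟩

lemma meanSubtreeOrder_eq {V : Type*} [Fintype V] {G : SimpleGraph V} (hG : G.IsTree) :
    meanSubtreeOrder G =
      Fintype.card V - deficiency Finset.univ (subtrees G) / numSubtrees G := by
  have h : (numSubtrees G : ℝ) ≠ 0 := by exact_mod_cast (numSubtrees_pos hG).ne'
  rw [meanSubtreeOrder, eq_sub_iff_add_eq, ← add_div, div_eq_iff h, deficiency,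
    Finset.sum_sub_distrib, totalSubtreeOrder, numSubtrees]
  simp
  ring

/-! ### Trees from parent maps, and families of supersets. -/

/-- The graph in which every vertex other than the root `r` is joined to its parent. -/
def parentGraph {V : Type*} (r : V) (f : V → V) : SimpleGraph V :=
  SimpleGraph.fromRel fun x y => x ≠ r ∧ f x = y

lemma parentGraph_adj {V : Type*} {r : V} {f : V → V} {x y : V} :
    (parentGraph r f).Adj x y ↔ x ≠ y ∧ (x ≠ r ∧ f x = y ∨ y ≠ r ∧ f y = x) :=
  SimpleGraph.fromRel_adj _ _ _

/-- The edge from an element of `X` of least rank to its parent leaves `X`. -/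
lemma rootedConn_parentGraph {V : Type*} {r : V} {f : V → V} {rank : V → ℕ}
    (hf : ∀ x, x ≠ r → rank (f x) < rank x) {S : Finset V} (hr : r ∈ S)
    (hS : ∀ x ∈ S, x ≠ r → f x ∈ S) : RootedConn (parentGraph r f) S r := by
  refine ⟨hr, fun X hX hne hrX => ?_⟩
  obtain ⟨x, hx, hmin⟩ := Finset.exists_min_image X rank hne
  have hxr : x ≠ r := fun h => hrX (h ▸ hx)
  have hlt := hf x hxr
  refine ⟨x, hx, f x, hS x (hX hx) hxr, fun h => (hmin _ h).not_gt hlt, ?_⟩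
  exact parentGraph_adj.2 ⟨fun h => by rw [← h] at hlt; exact lt_irrefl _ hlt,
    Or.inl ⟨hxr, rfl⟩⟩

lemma isTree_parentGraph {V : Type*} [Fintype V] {r : V} {f : V → V} {rank : V → ℕ}
    (hf : ∀ x, x ≠ r → rank (f x) < rank x) : (parentGraph r f).IsTree := by
  classical
  have hc : (parentGraph r f).Connected := by
    have := rootedConn_parentGraph hf (Finset.mem_univ r) fun _ _ _ => Finset.mem_univ _
    rw [rootedConn_iff_induce_connected (Finset.mem_univ r), Finset.coe_univ] at this
    exact (SimpleGraph.induceUnivIso _).connected_iff.1 this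
  refine SimpleGraph.isTree_iff_connected_and_card.2 ⟨hc, le_antisymm ?_ ?_⟩
  · have hsub : (parentGraph r f).edgeFinset ⊆
        (Finset.univ.erase r).image fun x => s(x, f x) := by
      intro e he
      induction e with
      | _ x y =>
      rw [SimpleGraph.mem_edgeFinset, SimpleGraph.mem_edgeSet, parentGraph_adj] at he
      rw [Finset.mem_image]
      rcases he.2 with ⟨h, rfl⟩ | ⟨h, rfl⟩
      · exact ⟨x, by simp [h], rfl⟩
      · exact ⟨y, by simp [h], Sym2.eq_swap⟩
    have h1 := (Finset.card_le_card hsub).trans Finset.card_image_le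
    rw [Finset.card_erase_of_mem (Finset.mem_univ r), Finset.card_univ] at h1
    have h2 : 0 < Fintype.card V := Fintype.card_pos_iff.2 ⟨r⟩
    rw [Nat.card_eq_fintype_card, Nat.card_eq_fintype_card, ← SimpleGraph.edgeFinset_card]
    omega
  · exact hc.card_vert_le_card_edgeSet_add_one

/-- The involution `S ↦ P ∪ Sᶜ` exchanges the missed vertices with the chosen vertices outside `P`.
-/
lemma deficiency_Icc_univ {V : Type*} [Fintype V] [DecidableEq V] (P : Finset V) :
    2 * deficiency Finset.univ (Finset.Icc P Finset.univ) =
      ((Fintype.card V : ℝ) - P.card) * (Finset.Icc P Finset.univ).card := by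
  have hinv : deficiency Finset.univ (Finset.Icc P Finset.univ) =
      ∑ S ∈ Finset.Icc P Finset.univ, ((S.card : ℝ) - P.card) := by
    refine Finset.sum_bij' (fun S _ => P ∪ Sᶜ) (fun S _ => P ∪ Sᶜ) ?_ ?_ ?_ ?_ ?_
    · intro S _; simp [Finset.subset_union_left]
    · intro S _; simp [Finset.subset_union_left]
    · intro S hS
      have : P ⊆ S := (Finset.mem_Icc.1 hS).1
      ext x
      have := @this x
      simp only [Finset.mem_union, Finset.mem_compl]
      tauto
    · intro S hS
      have : P ⊆ S := (Finset.mem_Icc.1 hS).1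
      ext x
      have := @this x
      simp only [Finset.mem_union, Finset.mem_compl]
      tauto
    · intro S hS
      have hPS : P ⊆ S := (Finset.mem_Icc.1 hS).1
      have h1 : (P ∪ Sᶜ).card = P.card + Sᶜ.card := Finset.card_union_of_disjoint
        (Finset.disjoint_left.2 fun x hx hx' => Finset.mem_compl.1 hx' (hPS hx))
      have h2 := Finset.card_add_card_compl S
      have h2' : (S.card : ℝ) + Sᶜ.card = Fintype.card V := by exact_mod_cast h2
      rw [h1, Finset.card_univ, ← h2']
      push_cast
      ring
  rw [two_mul]
  nth_rewrite 2 [hinv]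
  rw [deficiency, ← Finset.sum_add_distrib]
  simp only [sub_add_sub_cancel, Finset.sum_const, nsmul_eq_mul, Finset.card_univ]
  ring

/-! ### The double broom as comparison tree. -/

/-- The parent of a vertex in the double broom rooted at `k`. -/
def doubleBroomParent (n k : ℕ) (h : 2 * k < n) (i : Fin n) : Fin n :=
  -- The value at the root `k` is irrelevant: `parentGraph` ignores it.
  ⟨if i.1 < k then k else if n - k ≤ i.1 then n - k - 1 else i.1 - 1, by
    have := i.2; split_ifs <;> omega⟩

/-- The double broom: a path on the vertices `k, …, n - k - 1`, with `k` leaves attached to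
each of its ends. -/
def doubleBroom (n k : ℕ) (h : 2 * k < n) : SimpleGraph (Fin n) :=
  parentGraph ⟨k, by omega⟩ (doubleBroomParent n k h)

/-- A rank function that decreases from each vertex of the double broom to its parent. -/
def doubleBroomRank (n k : ℕ) (i : Fin n) : ℕ := if i.1 < k then 1 else i.1 - k

lemma doubleBroomRank_parent_lt {n k : ℕ} (h : 2 * k < n) (x : Fin n)
    (hx : x ≠ ⟨k, by omega⟩) :
    doubleBroomRank n k (doubleBroomParent n k h x) < doubleBroomRank n k x := by
  have hx' : x.1 ≠ k := fun h => hx (Fin.ext h)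
  have := x.2
  simp only [doubleBroomRank, doubleBroomParent]
  split_ifs <;> omega

lemma isTree_doubleBroom {n k : ℕ} (h : 2 * k < n) : (doubleBroom n k h).IsTree :=
  isTree_parentGraph (doubleBroomRank_parent_lt h)

lemma doubleBroom_not_adj {n k : ℕ} (h : 2 * k < n) {x c y : Fin n} (hc : k ≤ c.1)
    (hc' : c.1 < n - k) (hx : x < c) (hy : c < y) : ¬ (doubleBroom n k h).Adj x y := by
  rw [doubleBroom, parentGraph_adj]
  rw [Fin.lt_def] at hx hy
  simp only [ne_eq, Fin.ext_iff, doubleBroomParent]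
  split_ifs <;> omega

lemma mem_of_doubleBroom_rootedConn {n k : ℕ} (h : 2 * k < n) {S : Finset (Fin n)} {v : Fin n}
    (hS : RootedConn (doubleBroom n k h) S v) {a b c : Fin n} (ha : a ∈ S) (hb : b ∈ S)
    (hac : a ≤ c) (hcb : c ≤ b) (hc : k ≤ c.1) (hc' : c.1 < n - k) : c ∈ S := by
  by_contra hcS
  have hac' : a < c := lt_of_le_of_ne hac fun e => hcS (e ▸ ha)
  have hcb' : c < b := lt_of_le_of_ne hcb fun e => hcS (e ▸ hb)
  obtain ⟨x, hx, y, hy, hyX, hxy⟩ := (hS.reroot ha).2 (S.filter fun z => c < z)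
    (Finset.filter_subset _ _) ⟨b, by simp [hb, hcb']⟩ (by simp [hac])
  rw [Finset.mem_filter] at hx hyX
  have hyc : y < c := by
    refine lt_of_le_of_ne (not_lt.1 fun h => hyX ⟨hy, h⟩) fun e => hcS (e ▸ hy)
  exact doubleBroom_not_adj h hc hc' hyc hx.2 hxy.symm

/-- Path vertices are filled in between any two elements of a subtree. One that misses part of the
path `Icc p q` therefore contains `p` (left leaves plus an initial segment), or `q` (the mirror
image), or is an inner segment, or consists of leaves of one end. -/
lemma subtrees_doubleBroom_sdiff_subset {n k : ℕ} (h : 2 * k < n) {p q : Fin n}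
    (hp : p.1 = k) (hq : q.1 = n - k - 1) :
    subtrees (doubleBroom n k h) \ Finset.Icc (Finset.Icc p q) Finset.univ ⊆
      (((Finset.univ ×ˢ (Finset.Iio p).powerset).image fun t => t.2 ∪ Finset.Icc p t.1) ∪
      ((Finset.univ ×ˢ (Finset.Ioi q).powerset).image fun t => t.2 ∪ Finset.Icc t.1 q)) ∪
      ((Finset.univ ×ˢ Finset.univ).image fun t => Finset.Icc t.1 t.2) ∪
      ((Finset.Iio p).powerset ∪ (Finset.Ioi q).powerset) := by
  intro S hS
  obtain ⟨hS, hPS⟩ := Finset.mem_sdiff.1 hS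
  obtain ⟨v, hv⟩ := (mem_subtrees_iff (isTree_doubleBroom h).isAcyclic).1 hS
  have fill : ∀ a b c : Fin n, a ∈ S → b ∈ S → a ≤ c → c ≤ b → p ≤ c → c ≤ q → c ∈ S := by
    intro a b c ha hb hac hcb hpc hcq
    rw [Fin.le_def] at hpc hcq
    exact mem_of_doubleBroom_rootedConn h hv ha hb hac hcb (by omega) (by omega)
  have hne : S.Nonempty := ⟨v, hv.1⟩
  have hminS := S.min'_mem hne
  have hmaxS := S.max'_mem hne
  have hpq : p ≤ q := by rw [Fin.le_def]; omega
  obtain ⟨c, hcP, hcS⟩ : ∃ c ∈ Finset.Icc p q, c ∉ S := by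
    by_contra! hcon
    exact hPS (Finset.mem_Icc.2 ⟨hcon, Finset.subset_univ _⟩)
  obtain ⟨hpc, hcq⟩ := Finset.mem_Icc.1 hcP
  simp only [Finset.mem_union, Finset.mem_image, Finset.mem_product, Finset.mem_univ, true_and,
    Finset.mem_powerset, Prod.exists]
  by_cases hpS : p ∈ S
  · left; left; left
    refine ⟨S.max' hne, S ∩ Finset.Iio p, Finset.inter_subset_right, ?_⟩
    have hlt : S.max' hne ≤ c := not_lt.1 fun hlt => hcS (fill p _ c hpS hmaxS hpc hlt.le hpc hcq)
    ext x
    simp only [Finset.mem_union, Finset.mem_inter, Finset.mem_Iio, Finset.mem_Icc]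
    constructor
    · rintro (h | h)
      · exact h.1
      · exact fill p _ x hpS hmaxS h.1 h.2 h.1 (h.2.trans (hlt.trans hcq))
    · intro hx
      rcases lt_or_ge x p with h | h
      · exact Or.inl ⟨hx, h⟩
      · exact Or.inr ⟨h, S.le_max' x hx⟩
  by_cases hqS : q ∈ S
  · left; left; right
    refine ⟨S.min' hne, S ∩ Finset.Ioi q, Finset.inter_subset_right, ?_⟩
    have hlt : c ≤ S.min' hne := not_lt.1 fun hlt => hcS (fill _ q c hminS hqS hlt.le hcq hpc hcq)
    ext x
    simp only [Finset.mem_union, Finset.mem_inter, Finset.mem_Ioi, Finset.mem_Icc]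
    constructor
    · rintro (h | h)
      · exact h.1
      · exact fill _ q x hminS hqS h.1 h.2 (hpc.trans (hlt.trans h.1)) h.2
    · intro hx
      rcases lt_or_ge q x with h | h
      · exact Or.inl ⟨hx, h⟩
      · exact Or.inr ⟨S.min'_le x hx, h⟩
  rcases lt_or_ge (S.max' hne) p with h1 | h1
  · right; left
    exact fun x hx => Finset.mem_Iio.2 ((S.le_max' x hx).trans_lt h1)
  rcases lt_or_ge q (S.min' hne) with h2 | h2
  · right; right
    exact fun x hx => Finset.mem_Ioi.2 (h2.trans_le (S.min'_le x hx))
  have h1' : p ≤ S.min' hne := not_lt.1 fun hlt =>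
    hpS (fill _ _ p hminS hmaxS hlt.le h1 le_rfl hpq)
  have h2' : S.max' hne ≤ q := not_lt.1 fun hlt =>
    hqS (fill _ _ q hminS hmaxS h2 hlt.le hpq le_rfl)
  left; right
  refine ⟨S.min' hne, S.max' hne, ?_⟩
  ext x
  rw [Finset.mem_Icc]
  exact ⟨fun h => fill _ _ x hminS hmaxS h.1 h.2 (h1'.trans h.1) (h.2.trans h2'),
    fun hx => ⟨S.min'_le x hx, S.le_max' x hx⟩⟩

/-- The 4^k subtrees containing the path have mean deficiency k. The others number at most 5n·2^k
and miss at most n vertices each; `n ^ 2 ≤ 2 ^ k` makes their total at most 5·4^k. -/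
lemma deficiency_doubleBroom_le {n k : ℕ} (h : 2 * k < n) (hk : n ^ 2 ≤ 2 ^ k) :
    deficiency Finset.univ (subtrees (doubleBroom n k h)) ≤
      ((k : ℝ) + 5) * numSubtrees (doubleBroom n k h) := by
  obtain ⟨p, hp⟩ : ∃ p : Fin n, p.1 = k := ⟨⟨k, by omega⟩, rfl⟩
  obtain ⟨q, hq⟩ : ∃ q : Fin n, q.1 = n - k - 1 := ⟨⟨n - k - 1, by omega⟩, rfl⟩
  have hfull : Finset.Icc (Finset.Icc p q) Finset.univ ⊆ subtrees (doubleBroom n k h) := by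
    intro S hS
    have hPS : Finset.Icc p q ⊆ S := (Finset.mem_Icc.1 hS).1
    have hp' : p = ⟨k, by omega⟩ := Fin.ext hp
    refine (mem_subtrees_iff (isTree_doubleBroom h).isAcyclic).2 ⟨⟨k, by omega⟩,
      rootedConn_parentGraph (doubleBroomRank_parent_lt h) (hPS ?_) fun x _ hx => hPS ?_⟩
    · rw [Finset.mem_Icc, Fin.le_def, Fin.le_def]
      dsimp only
      omega
    · have hx' : x.1 ≠ k := fun h => hx (Fin.ext h)
      have := x.2
      rw [Finset.mem_Icc, Fin.le_def, Fin.le_def]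
      simp only [doubleBroomParent]
      split_ifs <;> omega
  have hPcard : (Finset.Icc p q).card = n - 2 * k := by rw [Fin.card_Icc]; omega
  have hfc : (Finset.Icc (Finset.Icc p q) Finset.univ).card = 2 ^ k * 2 ^ k := by
    rw [Finset.card_Icc_finset (Finset.subset_univ _), hPcard, Finset.card_univ,
      Fintype.card_fin, ← pow_add]
    congr 1; omega
  have hfd := deficiency_Icc_univ (Finset.Icc p q)
  rw [hPcard, Nat.cast_sub h.le, hfc, Fintype.card_fin] at hfd
  set E := subtrees (doubleBroom n k h) \ Finset.Icc (Finset.Icc p q) Finset.univ with hE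
  have hn1 : 1 ≤ n := by omega
  have hEcard : E.card ≤ 5 * n * 2 ^ k := by
    have hI : (Finset.Iio p).card = k := by rw [Fin.card_Iio, hp]
    have hJ : (Finset.Ioi q).card = k := by rw [Fin.card_Ioi, hq]; omega
    refine (Finset.card_le_card (subtrees_doubleBroom_sdiff_subset h hp hq)).trans ?_
    have c1 := Finset.card_image_le (s := Finset.univ ×ˢ (Finset.Iio p).powerset)
      (f := fun t => t.2 ∪ Finset.Icc p t.1)
    have c2 := Finset.card_image_le (s := Finset.univ ×ˢ (Finset.Ioi q).powerset)
      (f := fun t => t.2 ∪ Finset.Icc t.1 q)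
    have c3 := Finset.card_image_le (s := (Finset.univ ×ˢ Finset.univ : Finset (Fin n × Fin n)))
      (f := fun t => Finset.Icc t.1 t.2)
    rw [Finset.card_product, Finset.card_powerset, Finset.card_univ, Fintype.card_fin, hI] at c1
    rw [Finset.card_product, Finset.card_powerset, Finset.card_univ, Fintype.card_fin, hJ] at c2
    rw [Finset.card_product, Finset.card_univ, Fintype.card_fin] at c3
    refine (Finset.card_union_le _ _).trans ((Nat.add_le_add ((Finset.card_union_le _ _).trans
      (Nat.add_le_add ((Finset.card_union_le _ _).trans (Nat.add_le_add c1 c2)) c3))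
      (Finset.card_union_le _ _)).trans ?_)
    rw [Finset.card_powerset, Finset.card_powerset, hI, hJ]
    have e1 : 2 ^ k ≤ n * 2 ^ k := Nat.le_mul_of_pos_left _ hn1
    nlinarith
  have hN : numSubtrees (doubleBroom n k h) = E.card + 2 ^ k * 2 ^ k := by
    rw [numSubtrees, ← hfc, hE, Finset.card_sdiff_add_card_eq_card hfull]
  have hF : deficiency Finset.univ (subtrees (doubleBroom n k h)) =
      deficiency Finset.univ E +
        deficiency Finset.univ (Finset.Icc (Finset.Icc p q) Finset.univ) := by
    rw [deficiency, deficiency, deficiency, hE, Finset.sum_sdiff hfull]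
  have hFE : deficiency Finset.univ E ≤ n * E.card := by
    rw [deficiency, mul_comm, ← nsmul_eq_mul]
    refine Finset.sum_le_card_nsmul _ _ _ fun S _ => ?_
    rw [Finset.card_univ, Fintype.card_fin]
    linarith [Nat.cast_nonneg (α := ℝ) S.card]
  have h1 : (n : ℝ) * E.card ≤ 5 * (2 ^ k * 2 ^ k) := by
    have : n * E.card ≤ 5 * (2 ^ k * 2 ^ k) :=
      calc n * E.card ≤ n * (5 * n * 2 ^ k) := Nat.mul_le_mul_left _ hEcard
        _ = 5 * (n ^ 2 * 2 ^ k) := by ring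
        _ ≤ 5 * (2 ^ k * 2 ^ k) := by gcongr
    exact_mod_cast this
  rw [hN, hF]
  push_cast at hfd ⊢
  have h2 : (0 : ℝ) ≤ ((k : ℝ) + 5) * E.card := by positivity
  nlinarith

/-! ### Mean deficiency of an arbitrary tree. -/

/-- A subtree that avoids the separating vertex misses one side of the separation entirely. -/
lemma IsSeparation.card_le_of_rootedConn {V : Type*} [Fintype V] [DecidableEq V]
    {G : SimpleGraph V} {A B S : Finset V} {v w : V} (h : IsSeparation G A B v)
    (hS : RootedConn G S w) (hv : v ∉ S) (hw : w ∈ A) : S.card + B.card ≤ Fintype.card V := by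
  have hdisj : Disjoint S B := by
    rw [Finset.disjoint_left]
    intro b hb hbB
    have hnot : ∀ x ∈ S, x ∈ B → x ∉ A := fun x hx hxB hxA => hv (by
      have : x ∈ A ∩ B := Finset.mem_inter.2 ⟨hxA, hxB⟩
      rw [h.inter, Finset.mem_singleton] at this
      exact this ▸ hx)
    obtain ⟨x, hx, y, hy, hyX, hxy⟩ := hS.2 (S ∩ B) Finset.inter_subset_left
      ⟨b, Finset.mem_inter.2 ⟨hb, hbB⟩⟩
      (fun hwB => hnot w hS.1 (Finset.mem_inter.1 hwB).2 hw)
    obtain ⟨hxS, hxB⟩ := Finset.mem_inter.1 hx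
    have hyA : y ∈ A := by
      have : y ∈ A ∪ B := by simp [h.union]
      exact (Finset.mem_union.1 this).resolve_right fun h' => hyX (Finset.mem_inter.2 ⟨hy, h'⟩)
    rcases h.adj y hyA x hxB hxy.symm with e | e
    · exact hv (e ▸ hy)
    · exact hv (e ▸ hxS)
  rw [← Finset.card_union_of_disjoint hdisj, ← Finset.card_univ]
  exact Finset.card_le_card (Finset.subset_univ _)

lemma exists_factorization_of_deficiency_le {V : Type*} [Fintype V] {G : SimpleGraph V}
    (hG : G.IsTree) {l : ℝ} (hn : 8 ≤ Fintype.card V) (hl : 24 * l ≤ Fintype.card V)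
    (hF : deficiency Finset.univ (subtrees G) ≤ l * numSubtrees G) :
    ∃ a b : ℕ, 1 ≤ a ∧ 1 ≤ b ∧ numSubtrees G ≤ 2 * (a * b) ∧ a * b ≤ numSubtrees G ∧
      Real.logb 2 a / 2 + Real.logb 2 b / 2 +
        (Fintype.card V : ℝ) ^ 2 / 72 * (1 / a + 1 / b) ≤ l := by
  classical
  obtain ⟨A, B, v, hsep, hA, hB⟩ := exists_balanced_separation hG (by omega)
  have hac := hG.isAcyclic
  have huniv : RootedConn G Finset.univ v := by
    rw [rootedConn_iff_induce_connected (Finset.mem_univ v), Finset.coe_univ]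
    exact (SimpleGraph.induceUnivIso G).connected_iff.2 hG.connected
  have hRA : RootedConn G A v := by
    have := huniv.inter_left (A := A) (B := B) hsep.union.ge hsep.mem.1
      fun x hx y hy hyA hxy => (hsep.adj x hx y hy hxy).resolve_right fun e => hyA (e ▸ hsep.mem.1)
    rwa [Finset.univ_inter] at this
  have hRB : RootedConn G B v := by
    have := huniv.inter_left (A := B) (B := A) hsep.symm.union.ge hsep.mem.2
      fun x hx y hy hyA hxy =>
        (hsep.symm.adj x hx y hy hxy).resolve_right fun e => hyA (e ▸ hsep.mem.2)
    rwa [Finset.univ_inter] at this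
  obtain ⟨a1, -, a3⟩ := rootedSubtrees_bounds hac A v hRA
  obtain ⟨b1, -, b3⟩ := rootedSubtrees_bounds hac B v hRB
  obtain ⟨hc, hd⟩ := rootedSubtrees_union_of_cut_vertex hsep.inter hsep.adj
  rw [hsep.union] at hc hd
  have hsub : rootedSubtrees G Finset.univ v ⊆ subtrees G := fun S hS =>
    (mem_subtrees_iff hac).2 ⟨v, (mem_rootedSubtrees.1 hS).2⟩
  set E := subtrees G \ rootedSubtrees G Finset.univ v with hE
  have hN : numSubtrees G = E.card + (rootedSubtrees G Finset.univ v).card := by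
    rw [numSubtrees, hE, Finset.card_sdiff_add_card_eq_card hsub]
  have hFs : deficiency Finset.univ (subtrees G) =
      deficiency Finset.univ E + deficiency Finset.univ (rootedSubtrees G Finset.univ v) := by
    rw [deficiency, deficiency, deficiency, hE, Finset.sum_sdiff hsub]
  have hFE : (Fintype.card V : ℝ) / 3 * E.card ≤ deficiency Finset.univ E := by
    rw [deficiency, mul_comm, ← nsmul_eq_mul]
    refine Finset.card_nsmul_le_sum _ _ _ fun S hS => ?_
    obtain ⟨hS, hSv⟩ := Finset.mem_sdiff.1 hS
    obtain ⟨w, hw⟩ := (mem_subtrees_iff hac).1 hS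
    have hvS : v ∉ S := fun hv =>
      hSv (mem_rootedSubtrees.2 ⟨Finset.subset_univ _, hw.reroot hv⟩)
    have hwAB : w ∈ A ∪ B := by simp [hsep.union]
    have h3 : 3 * S.card + Fintype.card V ≤ 3 * Fintype.card V := by
      rcases Finset.mem_union.1 hwAB with h | h
      · have := hsep.card_le_of_rootedConn hw hvS h
        omega
      · have := hsep.symm.card_le_of_rootedConn hw hvS h
        omega
    have h3' : (3 : ℝ) * S.card + Fintype.card V ≤ 3 * Fintype.card V := by exact_mod_cast h3
    rw [Finset.card_univ]
    linarith
  have hApos : 1 ≤ A.card := by omega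
  have hBpos : 1 ≤ B.card := by omega
  have hA' : (Fintype.card V : ℝ) + 1 ≤ 3 * A.card := by exact_mod_cast hA
  have hB' : (Fintype.card V : ℝ) + 1 ≤ 3 * B.card := by exact_mod_cast hB
  have hn' : (8 : ℝ) ≤ Fintype.card V := by exact_mod_cast hn
  rw [hFs, hd, hN, hc] at hF
  rw [hN, hc]
  have ha := hApos.trans a1
  have hb := hBpos.trans b1
  clear a1 b1 hc hd hN hFs hsub hRA hRB
  refine ⟨(rootedSubtrees G A v).card, (rootedSubtrees G B v).card, ha, hb, ?_⟩
  clear_value E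
  generalize (rootedSubtrees G A v).card = a at *
  generalize (rootedSubtrees G B v).card = b at *
  generalize deficiency A (rootedSubtrees G A v) = F₁ at *
  generalize deficiency B (rootedSubtrees G B v) = F₂ at *
  generalize (Fintype.card V : ℝ) = n at *
  generalize (A.card : ℝ) = m₁ at *
  generalize (B.card : ℝ) = m₂ at *
  have ha' : (1 : ℝ) ≤ a := by exact_mod_cast ha
  have hb' : (1 : ℝ) ≤ b := by exact_mod_cast hb
  have hla : 0 ≤ Real.logb 2 a := Real.logb_nonneg one_lt_two ha'
  have hlb : 0 ≤ Real.logb 2 b := Real.logb_nonneg one_lt_two hb'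
  have hF₁ : 0 ≤ F₁ := le_trans (by positivity) a3
  have hF₂ : 0 ≤ F₂ := le_trans (by positivity) b3
  have hEnn : (0 : ℝ) ≤ E.card := Nat.cast_nonneg _
  push_cast at hF
  -- Subtrees avoiding `v` have deficiency at least n/3 ≥ 2l, so dropping them does not raise the
  -- mean above `l`.
  have hFv : F₁ * b + a * F₂ + l * E.card ≤ l * (a * b) := by
    have h1 : 2 * l * E.card ≤ n / 3 * E.card := mul_le_mul_of_nonneg_right (by linarith) hEnn
    linarith
  have hab : (0 : ℝ) < a * b := by positivity
  have hFv0 : 0 ≤ F₁ * b + a * F₂ := by positivity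
  have hnE : n / 3 * E.card + (F₁ * b + a * F₂) ≤ l * (E.card + a * b) := by linarith
  -- Mean deficiency at most n/24 leaves room for few subtrees of deficiency n/3.
  have hEN : E.card ≤ a * b := by
    have h1 : n / 3 * (E.card : ℝ) ≤ n / 24 * (E.card + a * b) :=
      le_trans (by linarith) (mul_le_mul_of_nonneg_right (show l ≤ n / 24 by linarith)
        (by positivity : (0 : ℝ) ≤ E.card + a * b))
    have h2 : (E.card : ℝ) ≤ a * b := by
      by_contra! hlt
      nlinarith
    exact_mod_cast h2
  refine ⟨by omega, by omega, ?_⟩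
  have hl0 : 0 ≤ l := by
    by_contra! hneg
    have : l * (E.card + a * b) < 0 := mul_neg_of_neg_of_pos hneg (by positivity)
    have : 0 ≤ n / 3 * (E.card : ℝ) := by positivity
    linarith
  have hmean : F₁ / a + F₂ / b ≤ l := by
    rw [div_add_div _ _ (by positivity) (by positivity), div_le_iff₀ hab]
    have : 0 ≤ l * E.card := by positivity
    linarith
  have div_bound : ∀ {c F m : ℝ}, 1 ≤ c →
      c / 2 * Real.logb 2 c + (m - 1 - Real.logb 2 c) ^ 2 / 2 ≤ F →
      Real.logb 2 c / 2 + (m - 1 - Real.logb 2 c) ^ 2 / 2 * (1 / c) ≤ F / c := by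
    intro c F m hc h
    rw [le_div_iff₀ (by linarith)]
    refine le_trans (le_of_eq ?_) h
    field_simp
  have d1 := div_bound ha' a3
  have d2 := div_bound hb' b3
  have e1 : 0 ≤ (m₁ - 1 - Real.logb 2 a) ^ 2 / 2 * (1 / (a : ℝ)) := by positivity
  have e2 : 0 ≤ (m₂ - 1 - Real.logb 2 b) ^ 2 / 2 * (1 / (b : ℝ)) := by positivity
  -- Here log₂ a ≤ 2l ≤ n/12 and m₁ ≥ (n + 1)/3; `8 ≤ n` absorbs the remaining 2/3.
  have g1 : n ^ 2 / 72 ≤ (m₁ - 1 - Real.logb 2 a) ^ 2 / 2 := by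
    have : n / 6 ≤ m₁ - 1 - Real.logb 2 a := by linarith
    have := pow_le_pow_left₀ (by positivity) this 2
    linarith
  have g2 : n ^ 2 / 72 ≤ (m₂ - 1 - Real.logb 2 b) ^ 2 / 2 := by
    have : n / 6 ≤ m₂ - 1 - Real.logb 2 b := by linarith
    have := pow_le_pow_left₀ (by positivity) this 2
    linarith
  have k1 := mul_le_mul_of_nonneg_right g1 (show 0 ≤ 1 / (a : ℝ) by positivity)
  have k2 := mul_le_mul_of_nonneg_right g2 (show 0 ≤ 1 / (b : ℝ) by positivity)
  linarith

/-! ### Optimal trees and the final estimates. -/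

lemma IsOptimal.deficiency_le {V : Type*} [Fintype V] {T : SimpleGraph V} (hT : IsOptimal T)
    (hn : 24 * (2 * Real.logb 2 (Fintype.card V) + 6) ≤ Fintype.card V)
    (hn2 : 2 ≤ Fintype.card V) :
    deficiency Finset.univ (subtrees T) ≤
      (2 * Real.logb 2 (Fintype.card V) + 6) * numSubtrees T := by
  -- The broom uses the least `k` with n² ≤ 2^k, so k ≤ 2 log₂ n + 1.
  have hk1 : Fintype.card V ^ 2 ≤ 2 ^ Nat.clog 2 (Fintype.card V ^ 2) :=
    Nat.le_pow_clog one_lt_two _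
  have hk2 : 2 ^ (Nat.clog 2 (Fintype.card V ^ 2)).pred < Fintype.card V ^ 2 :=
    Nat.pow_pred_clog_lt_self one_lt_two (by nlinarith)
  have hkpos : 0 < Nat.clog 2 (Fintype.card V ^ 2) := Nat.clog_pos one_lt_two (by nlinarith)
  have hnpos : (0 : ℝ) < Fintype.card V := by exact_mod_cast (by omega : 0 < Fintype.card V)
  have hlog0 : 0 ≤ Real.logb 2 (Fintype.card V) :=
    Real.logb_nonneg one_lt_two (by exact_mod_cast (by omega : 1 ≤ Fintype.card V))
  generalize Nat.clog 2 (Fintype.card V ^ 2) = k at *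
  have hkle : (k : ℝ) ≤ 2 * Real.logb 2 (Fintype.card V) + 1 := by
    have h1 : (2 : ℝ) ^ ((k.pred : ℕ) : ℝ) ≤ (Fintype.card V : ℝ) ^ 2 := by
      rw [Real.rpow_natCast]; exact_mod_cast hk2.le
    have h2 := (Real.le_logb_iff_rpow_le one_lt_two (by positivity)).2 h1
    rw [Real.logb_pow, Nat.pred_eq_sub_one, Nat.cast_sub hkpos] at h2
    push_cast at h2
    linarith
  have h2k : 2 * k < Fintype.card V := by
    have : (2 : ℝ) * k < Fintype.card V := by linarith
    exact_mod_cast this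
  have hle := hT.2 _ (isTree_doubleBroom h2k)
  rw [meanSubtreeOrder_eq (isTree_doubleBroom h2k), meanSubtreeOrder_eq hT.1,
    Fintype.card_fin] at hle
  have hd := deficiency_doubleBroom_le h2k hk1
  have hp1 : (0 : ℝ) < numSubtrees (doubleBroom _ k h2k) := by
    exact_mod_cast numSubtrees_pos (isTree_doubleBroom h2k)
  have hp2 : (0 : ℝ) < numSubtrees T := by exact_mod_cast numSubtrees_pos hT.1
  rw [← div_le_iff₀ hp1] at hd
  rw [← div_le_iff₀ hp2]
  linarith

/-- The bounds on `a * b` that follow from the estimate of the mean deficiency. -/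
lemma mul_bounds_of_logb_add_le {n a b : ℝ} (hn : 1 ≤ n) (ha : 1 ≤ a) (hb : 1 ≤ b)
    (h : Real.logb 2 a / 2 + Real.logb 2 b / 2 + n ^ 2 / 72 * (1 / a + 1 / b) ≤
      2 * Real.logb 2 n + 6) :
    a * b ≤ 2 ^ 12 * n ^ 4 ∧ n ^ 4 / 20000 ^ 2 ≤ a * b := by
  have ha0 : 0 < a := by linarith
  have hb0 : 0 < b := by linarith
  have hn0 : 0 < n := by linarith
  have hlab : Real.logb 2 (a * b) = Real.logb 2 a + Real.logb 2 b :=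
    Real.logb_mul ha0.ne' hb0.ne'
  constructor
  · rw [← Real.logb_le_logb one_lt_two (by positivity) (by positivity), hlab,
      Real.logb_mul (by positivity) (by positivity), Real.logb_pow, Real.logb_pow,
      Real.logb_self_eq_one one_lt_two]
    have : 0 ≤ n ^ 2 / 72 * (1 / a + 1 / b) := by positivity
    push_cast
    linarith
  · set r := Real.sqrt (a * b) with hr
    have hr0 : 0 < r := Real.sqrt_pos.2 (by positivity)
    have hr2 : r ^ 2 = a * b := Real.sq_sqrt (by positivity)
    -- In terms of s = n²/√(ab) the hypothesis becomes s/36 ≤ log₂ s + 6, which bounds s.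
    set s := n ^ 2 / r with hs
    have hs0 : 0 < s := by positivity
    have hlog : Real.logb 2 a / 2 + Real.logb 2 b / 2 = 2 * Real.logb 2 n - Real.logb 2 s := by
      have h1 : Real.logb 2 s = 2 * Real.logb 2 n - Real.logb 2 r := by
        rw [hs, Real.logb_div (by positivity) hr0.ne', Real.logb_pow]; norm_num
      have h2 : 2 * Real.logb 2 r = Real.logb 2 a + Real.logb 2 b := by
        rw [← hlab, ← hr2, Real.logb_pow]; norm_num
      linarith
    have hamgm : 2 / r ≤ 1 / a + 1 / b := by
      rw [div_add_div _ _ ha0.ne' hb0.ne', ← hr2, div_le_div_iff₀ hr0 (by positivity)]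
      have : 2 * r ≤ a + b := by
        refine abs_le_of_sq_le_sq' ?_ (by positivity) |>.2
        nlinarith [sq_nonneg (a - b)]
      nlinarith
    have hmul : s / 36 ≤ n ^ 2 / 72 * (1 / a + 1 / b) := by
      refine le_trans (le_of_eq ?_) (mul_le_mul_of_nonneg_left hamgm (by positivity))
      rw [hs]; field_simp; norm_num
    -- A linear bound whose slope 1/72 is half of 1/36; the factor 3/2 exceeds 1/log 2.
    have hls : Real.logb 2 s ≤ 3 / 2 * (s / 108 + 106) := by
      have h1 : Real.log s ≤ s / 108 + 106 := by
        have e1 := Real.log_le_sub_one_of_pos (show 0 < s / 108 by positivity)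
        have e2 := Real.log_le_sub_one_of_pos (show (0 : ℝ) < 108 by norm_num)
        rw [Real.log_div hs0.ne' (by norm_num)] at e1
        linarith
      have h2 := Real.log_two_gt_d9
      rw [Real.logb, div_le_iff₀ (by linarith)]
      refine h1.trans ?_
      have : 0 ≤ s / 108 + 106 := by positivity
      nlinarith
    have hsK : s ≤ 20000 := by linarith
    rw [hs, div_le_iff₀ hr0] at hsK
    rw [div_le_iff₀ (by norm_num), ← hr2]
    calc n ^ 4 = (n ^ 2) ^ 2 := by ring
      _ ≤ (20000 * r) ^ 2 := pow_le_pow_left₀ (by positivity) hsK 2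
      _ = r ^ 2 * 20000 ^ 2 := by ring

lemma exists_forall_logb_le : ∃ n₀ : ℕ, 8 ≤ n₀ ∧ ∀ n : ℕ, n₀ ≤ n →
    24 * (2 * Real.logb 2 n + 6) ≤ n := by
  have h1 : ∀ᶠ x : ℝ in Filter.atTop, Real.log x ≤ 1 / 200 * x := by
    filter_upwards [Real.isLittleO_log_id_atTop.bound (show (0 : ℝ) < 1 / 200 by norm_num),
      Filter.eventually_ge_atTop 0] with x hx hx0
    rw [id, Real.norm_eq_abs, Real.norm_eq_abs, abs_of_nonneg hx0] at hx
    exact (le_abs_self _).trans hx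
  obtain ⟨n₁, hn₁⟩ := Filter.eventually_atTop.1 (tendsto_natCast_atTop_atTop.eventually h1)
  refine ⟨max n₁ 1000, by omega, fun n hn => ?_⟩
  have e1 := hn₁ n (by omega)
  have e2 : (1000 : ℝ) ≤ n := by exact_mod_cast (by omega : 1000 ≤ n)
  have h2 := Real.log_two_gt_d9
  have : Real.logb 2 n ≤ 3 / 2 * (1 / 200 * n) := by
    rw [Real.logb, div_le_iff₀ (by linarith)]
    nlinarith
  linarith

end MeanSubtree

theorem mainTheorem5 :
    ∃ C₁ C₂ : ℝ, 0 < C₁ ∧ 0 < C₂ ∧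
      ∀ (V : Type*) [Fintype V] (T : SimpleGraph V), MeanSubtree.IsOptimal T →
        (MeanSubtree.numSubtrees T : ℝ) ≤ C₁ * (Fintype.card V : ℝ) ^ 4 ∧
        C₂ * (Fintype.card V : ℝ) ^ 4 ≤ (MeanSubtree.numSubtrees T : ℝ) := by
  obtain ⟨n₀, hn₀, hlog⟩ := MeanSubtree.exists_forall_logb_le
  have hn₀' : (0 : ℝ) < n₀ := by exact_mod_cast (by omega : 0 < n₀)
  -- The first entries serve n ≥ n₀, where 2^13 is 2^12 times the factor 2 in N ≤ 2ab. The second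
  -- entries serve n < n₀, through 1 ≤ N ≤ 2^n.
  refine ⟨max (2 ^ 13) (2 ^ n₀), min (1 / 20000 ^ 2) (1 / (n₀ : ℝ) ^ 4), by positivity,
    by positivity, fun V _ T hT => ?_⟩
  have hpos := MeanSubtree.numSubtrees_pos hT.1
  have hV : 1 ≤ Fintype.card V := by
    obtain ⟨v⟩ := hT.1.connected.nonempty
    exact Fintype.card_pos_iff.2 ⟨v⟩
  have hV' : (1 : ℝ) ≤ Fintype.card V := by exact_mod_cast hV
  rcases le_or_gt n₀ (Fintype.card V) with h | h
  · have hl := hlog _ h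
    obtain ⟨a, b, ha, hb, h1, h2, h3⟩ := MeanSubtree.exists_factorization_of_deficiency_le hT.1
      (hn₀.trans h) hl (hT.deficiency_le hl (by omega))
    obtain ⟨h4, h5⟩ := MeanSubtree.mul_bounds_of_logb_add_le hV' (by exact_mod_cast ha)
      (by exact_mod_cast hb) h3
    have h1' : (MeanSubtree.numSubtrees T : ℝ) ≤ 2 * (a * b) := by exact_mod_cast h1
    have h2' : (a : ℝ) * b ≤ MeanSubtree.numSubtrees T := by exact_mod_cast h2
    constructor
    · calc (MeanSubtree.numSubtrees T : ℝ) ≤ 2 ^ 13 * (Fintype.card V : ℝ) ^ 4 := by linarith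
        _ ≤ _ := mul_le_mul_of_nonneg_right (le_max_left _ _) (by positivity)
    · calc _ ≤ 1 / 20000 ^ 2 * (Fintype.card V : ℝ) ^ 4 :=
            mul_le_mul_of_nonneg_right (min_le_left _ _) (by positivity)
        _ ≤ _ := by linarith
  · have hone : (1 : ℝ) ≤ (Fintype.card V : ℝ) ^ 4 := one_le_pow₀ hV'
    constructor
    · have h1 : MeanSubtree.numSubtrees T ≤ 2 ^ Fintype.card V := by
        refine (Finset.card_le_univ _).trans_eq ?_
        rw [Fintype.card_finset]
      calc (MeanSubtree.numSubtrees T : ℝ) ≤ 2 ^ Fintype.card V := by exact_mod_cast h1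
        _ ≤ 2 ^ n₀ := pow_le_pow_right₀ one_le_two h.le
        _ ≤ max (2 ^ 13) (2 ^ n₀) := le_max_right _ _
        _ ≤ _ := le_mul_of_one_le_right (by positivity) hone
    · calc _ ≤ 1 / (n₀ : ℝ) ^ 4 * (Fintype.card V : ℝ) ^ 4 :=
            mul_le_mul_of_nonneg_right (min_le_right _ _) (by positivity)
        _ ≤ 1 := by
            rw [one_div_mul_eq_div, div_le_one (by positivity)]
            exact pow_le_pow_left₀ (by positivity) (by exact_mod_cast h.le) 4
        _ ≤ _ := by exact_mod_cast hpos
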